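/- Call a map $f:\mathbb{R}^n\to\mathbb{R}^n$ \emph{monotone} if $x\le y$ (entrywise) implies $f(x)\le f(y)$, \emph{homogeneous} if $f(c+x)=c+f(x)$ for all $c\in\mathbb{R}$, $x\in\mathbb{R}^n$, where $c+x=(c+x_1,\dots,c+x_n)$, and \emph{convex} if its coordinates are convex. An \emph{eigenvector} of $f$ is a $v\in\mathbb{R}^n$ with $f(v)=c+v$ for some $c\in\mathbb{R}$. The subdifferential of $f$ at $x$ is $$\partial f(x)=\{P\in\mathbb{R}^{n\times n} : f(y)-f(x)\ge P(y-x)\ \text{ for all } y\in\mathbb{R}^n\}.$$ The graph of an $n\times n$ matrix $P$ has nodes $1,\dots,n$ and an arc $i\to j$ whenever $P_{ij}\neq 0$. Its classes are the equivalence classes of mutual access (each node having access to itself), and a class is \emph{final} if no node of it has access to a node outside it. The \emph{final graph} of $P$ consists of the nodes belonging to final classes of $P$, and of the arcs of the graph of $P$ joining two nodes of the same final class. If $f$ is convex, monotone and homogeneous and has an eigenvector $v$, the \emph{critical graph} $\mathcal{G}^{c}(f)$ of $f$ is the union of the final graphs of the matrices $P\in\partial f(v)$; it does not depend on the choice of the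 eigenvector $v$. Its nodes are called the critical nodes of $f$, and their set is denoted by $N^{c}(f)$. Finally, for a directed graph $\mathcal{G}$ and $k\ge 1$, $\mathcal{G}^k$ is the graph with the same nodes as $\mathcal{G}$ and with an arc $i\to j$ whenever there is a directed path of length $k$ from $i$ to $j$ in $\mathcal{G}$. \textbf{Theorem.} Let $f:\mathbb{R}^n\to\mathbb{R}^n$ be a convex monotone homogeneous map that has an eigenvector. Then, for all $k\ge 1$, the $k$-th iterate $f^k$ also has an eigenvector, and $$\mathcal{G}^{c}(f^k)=\mathcal{G}^{c}(f)^k ,$$ where the two critical graphs may be computed at any eigenvector of $f^k$ and at any eigenvector of $f$, respectively. In particular, $N^{c}(f^k)=N^{c}(f)$. -/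

import Mathlib

namespace ConvexSpectral

/-- A directed graph (loops allowed) given by a set of nodes, taken inside an ambient type `V`, and
a set of arcs joining nodes. -/
@[ext]
structure NodeDigraph (V : Type*) where
  /-- The set of nodes. -/
  nodes : Set V
  /-- `Arc i j` means that `i → j` is an arc. -/
  Arc : V → V → Prop
  left_mem : ∀ {i j : V}, Arc i j → i ∈ nodes
  right_mem : ∀ {i j : V}, Arc i j → j ∈ nodes

namespace NodeDigraph

variable {V : Type*}

/-- `i` has access to `j`: there is a directed path from `i` to `j`, or `i = j`. -/
def HasAccess (G : NodeDigraph V) (i j : V) : Prop :=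
  Relation.ReflTransGen G.Arc i j

/-- The classes of `G`: the equivalence classes, in the set of nodes, of mutual access. -/
def classes (G : NodeDigraph V) : Set (Set V) :=
  {C | ∃ i ∈ G.nodes, C = {j | j ∈ G.nodes ∧ G.HasAccess i j ∧ G.HasAccess j i}}

/-- The final classes of `G`: the classes `C` such that no node of `C` has access to a node outside
`C`. -/
def finalClasses (G : NodeDigraph V) : Set (Set V) :=
  {C | C ∈ G.classes ∧ ∀ i ∈ C, ∀ j ∈ G.nodes, G.HasAccess i j → j ∈ C}

/-- The restriction of `G` to a set `C` of nodes. -/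
def restrict (G : NodeDigraph V) (C : Set V) : NodeDigraph V where
  nodes := G.nodes ∩ C
  Arc i j := G.Arc i j ∧ i ∈ C ∧ j ∈ C
  left_mem h := ⟨G.left_mem h.1, h.2.1⟩
  right_mem h := ⟨G.right_mem h.1, h.2.2⟩

/-- The union of a set of graphs: nodes and arcs are those of the members. -/
def sUnion (S : Set (NodeDigraph V)) : NodeDigraph V where
  nodes := {i | ∃ G ∈ S, i ∈ G.nodes}
  Arc i j := ∃ G ∈ S, G.Arc i j
  left_mem := fun ⟨G, hG, h⟩ => ⟨G, hG, G.left_mem h⟩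
  right_mem := fun ⟨G, hG, h⟩ => ⟨G, hG, G.right_mem h⟩

/-- `G.HasPath k i j`: there is a directed path `i → i₁ → ⋯ → i_k = j` of length `k` in `G`. -/
def HasPath (G : NodeDigraph V) : ℕ → V → V → Prop
  | 0, i, j => i ∈ G.nodes ∧ i = j
  | k + 1, i, j => ∃ l, G.HasPath k i l ∧ G.Arc l j

theorem HasPath.left_mem {G : NodeDigraph V} :
    ∀ {k : ℕ} {i j : V}, G.HasPath k i j → i ∈ G.nodes
  | 0, _, _, h => h.1
  | _ + 1, _, _, ⟨_, h, _⟩ => HasPath.left_mem h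

theorem HasPath.right_mem {G : NodeDigraph V} :
    ∀ {k : ℕ} {i j : V}, G.HasPath k i j → j ∈ G.nodes
  | 0, _, _, h => h.2 ▸ h.1
  | _ + 1, _, _, ⟨_, _, h⟩ => G.right_mem h

/-- The power `G ^ k`: same nodes as `G`, and an arc `i → j` for every directed path of length `k`
from `i` to `j` in `G`. -/
instance : Pow (NodeDigraph V) ℕ where
  pow G k :=
    { nodes := G.nodes
      Arc := G.HasPath k
      left_mem := HasPath.left_mem
      right_mem := HasPath.right_mem }

end NodeDigraph

/-- The graph of an `n × n` matrix `P`: nodes `1, …, n`, arcs `i → j` when `P i j ≠ 0`. -/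
def matrixGraph {n : ℕ} (P : Matrix (Fin n) (Fin n) ℝ) : NodeDigraph (Fin n) where
  nodes := Set.univ
  Arc i j := P i j ≠ 0
  left_mem _ := Set.mem_univ _
  right_mem _ := Set.mem_univ _

/-- The final graph of `P`: the union, over the final classes `F` of `P`, of the restrictions to `F`
of the graph of `P`. -/
def finalGraph {n : ℕ} (P : Matrix (Fin n) (Fin n) ℝ) : NodeDigraph (Fin n) :=
  NodeDigraph.sUnion ((matrixGraph P).restrict '' (matrixGraph P).finalClasses)

/-- A map `ℝⁿ → ℝⁿ` is convex when its coordinates are convex. -/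
def IsConvexMap {n : ℕ} (f : (Fin n → ℝ) → (Fin n → ℝ)) : Prop :=
  ∀ i, ConvexOn ℝ Set.univ (fun x => f x i)

/-- Additive homogeneity: `f (c + x) = c + f x` for all real constants `c`. -/
def IsAddHomogeneous {n : ℕ} (f : (Fin n → ℝ) → (Fin n → ℝ)) : Prop :=
  ∀ (c : ℝ) (x : Fin n → ℝ), f (fun i => c + x i) = fun i => c + f x i

/-- `v` is an (additive) eigenvector of `f`: `f v = c + v` for some real `c`, the eigenvalue. -/
def IsEigenvector {n : ℕ} (f : (Fin n → ℝ) → (Fin n → ℝ)) (v : Fin n → ℝ) : Prop :=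
  ∃ c : ℝ, f v = fun i => c + v i

/-- The subdifferential of `f` at `x`: the matrices `P` with `f y - f x ≥ P (y - x)`, entrywise, for
all `y`. -/
def subdifferential {n : ℕ} (f : (Fin n → ℝ) → (Fin n → ℝ)) (x : Fin n → ℝ) :
    Set (Matrix (Fin n) (Fin n) ℝ) :=
  {P | ∀ y, P.mulVec (y - x) ≤ f y - f x}

/-- The critical graph of `f`, computed at the eigenvector `v` of `f`: the union of the final graphs
of the matrices of the subdifferential of `f` at `v`. -/
def criticalGraph {n : ℕ} (f : (Fin n → ℝ) → (Fin n → ℝ)) (v : Fin n → ℝ) :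
    NodeDigraph (Fin n) :=
  NodeDigraph.sUnion (finalGraph '' subdifferential f v)

/-- The critical nodes of `f`, computed at the eigenvector `v` of `f`. -/
def criticalNodes {n : ℕ} (f : (Fin n → ℝ) → (Fin n → ℝ)) (v : Fin n → ℝ) : Set (Fin n) :=
  (criticalGraph f v).nodes

end ConvexSpectral

open Matrix

namespace ConvexSpectral

/-! ### Separation and subgradients -/

/-! Subgradients of a monotone homogeneous map are stochastic matrices, and a node of a stochastic
matrix lies in a final class exactly when some invariant measure charges it. So the critical arcs
are the pairs with `P i j ≠ 0` and `0 < m i`, for some subgradient `P` at the eigenvector and some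
`P`-invariant `m` (`criticalGraph_arc_iff`). In this form they can be averaged: `exists_mixture`
merges measures and subgradients with balanced total flow into one pair that keeps all their arcs.

Averaging over all critical arcs gives one `P` carrying the whole critical graph. Since `P ^ k` is a
subgradient of `f^[k]` with the same invariant measure, paths of length `k` become critical arcs of
`f^[k]`. Conversely, by the chain rule (`exists_chainLaw_eq`) each row of a subgradient `R` of
`f^[k]` is the time-`k` law of a chain with kernels in the subdifferential of `f`. Started from an
`R`-invariant measure, the chains jointly return to it at time `k`, so the flow over times `0, …, k
- 1` balances and mixing makes every transition used a critical arc.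

The eigenvector is irrelevant because, integrated against an invariant measure, the subgradient
inequality between two eigenvectors is an equality (`criticalGraph_congr`). -/

/-- A convex function and a convex set lying below its graph, touching it at the origin, are
separated by the graph of an affine function. -/
theorem exists_linear_between {E : Type*} [NormedAddCommGroup E] [NormedSpace ℝ E]
    [FiniteDimensional ℝ E] {Φ : E → ℝ} (hΦ : ConvexOn ℝ Set.univ Φ) {C : Set (E × ℝ)}
    (hC : Convex ℝ C) (h0 : (0, Φ 0) ∈ C) (hle : ∀ z ∈ C, z.2 ≤ Φ z.1) :
    ∃ l : E →ₗ[ℝ] ℝ, (∀ z, Φ 0 + l z ≤ Φ z) ∧ ∀ z ∈ C, z.2 ≤ Φ 0 + l z.1 := by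
  have hcont : Continuous Φ := continuousOn_univ.1 (hΦ.continuousOn isOpen_univ)
  have hs : Convex ℝ {z : E × ℝ | Φ z.1 < z.2} := by
    simpa using hΦ.convex_strict_epigraph
  have ho : IsOpen {z : E × ℝ | Φ z.1 < z.2} := isOpen_lt (by fun_prop) (by fun_prop)
  obtain ⟨g, u, hg1, hg2⟩ := geometric_hahn_banach_open hs ho hC
    (Set.disjoint_left.2 fun z hz hzC => absurd (hle z hzC) (not_le.2 hz))
  set a := g (0, 1) with ha
  have hsplit : ∀ z t, g (z, t) = g (z, 0) + t * a := by
    intro z t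
    have : ((z, t) : E × ℝ) = (z, 0) + t • (0, 1) := by simp
    rw [this, map_add, map_smul, smul_eq_mul]
  have hz0 : g ((0 : E), (0 : ℝ)) = 0 := map_zero g
  have hu : u ≤ Φ 0 * a := by
    have := hg2 _ h0
    rwa [hsplit, hz0, zero_add] at this
  have hneg : a < 0 := by
    have := hg1 (0, Φ 0 + 1) (by simp)
    rw [hsplit, hz0] at this
    linarith
  have hlim : ∀ z, g (z, 0) + Φ z * a ≤ u := by
    intro z
    by_contra! h
    -- This height above the graph is the one at which `g` equals `u`, contradicting the strict
    -- bound on the open epigraph.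
    have hpos : 0 < (g (z, 0) + Φ z * a - u) / (-a) := div_pos (by linarith) (by linarith)
    have h1 := hg1 (z, Φ z + (g (z, 0) + Φ z * a - u) / (-a)) (by simpa using hpos)
    rw [hsplit] at h1
    have h2 : (g (z, 0) + Φ z * a - u) / (-a) * a = -(g (z, 0) + Φ z * a - u) := by
      rw [div_neg, neg_mul, div_mul_cancel₀ _ hneg.ne]
    linarith
  -- The hyperplane `g = u` solved for its last coordinate; `hu` and `hlim 0` make it pass through
  -- `(0, Φ 0)`.
  refine ⟨(-a)⁻¹ • (g.toLinearMap ∘ₗ LinearMap.inl ℝ E ℝ), fun z => ?_, fun z hz => ?_⟩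
  · have h1 := hlim z
    have h2 : (-a)⁻¹ * g (z, 0) ≤ Φ z - Φ 0 := by
      rw [inv_mul_le_iff₀ (by linarith)]
      linarith
    simpa using (by linarith : Φ 0 + (-a)⁻¹ * g (z, 0) ≤ Φ z)
  · have h1 := hg2 z hz
    have h3 := hlim 0
    rw [← Prod.mk.eta (p := z), hsplit] at h1
    rw [hz0] at h3
    have h2 : z.2 - Φ 0 ≤ (-a)⁻¹ * g (z.1, 0) := by
      rw [le_inv_mul_iff₀ (by linarith)]
      linarith
    simpa using (by linarith : z.2 ≤ Φ 0 + (-a)⁻¹ * g (z.1, 0))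

variable {n : ℕ}

/-- `p` is a subgradient of the scalar function `φ` at `x`. -/
def IsSubgradient (φ : (Fin n → ℝ) → ℝ) (x p : Fin n → ℝ) : Prop :=
  ∀ y, p ⬝ᵥ (y - x) ≤ φ y - φ x

theorem mem_subdifferential_iff {f : (Fin n → ℝ) → (Fin n → ℝ)} {x : Fin n → ℝ}
    {P : Matrix (Fin n) (Fin n) ℝ} :
    P ∈ subdifferential f x ↔ ∀ i, IsSubgradient (fun y => f y i) x (P i) :=
  ⟨fun h i y => h y i, fun h y i => h i y⟩

theorem linearMap_apply_eq_dotProduct (l : (Fin n → ℝ) →ₗ[ℝ] ℝ) (z : Fin n → ℝ) :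
    l z = (fun j => l (Pi.single j 1)) ⬝ᵥ z := by
  rw [LinearMap.pi_apply_eq_sum_univ l z]
  simp only [dotProduct, smul_eq_mul]
  refine Finset.sum_congr rfl fun j _ => ?_
  rw [mul_comm]
  congr 2
  ext i
  simp [Pi.single_apply, eq_comm]

theorem convexOn_translate {φ : (Fin n → ℝ) → ℝ} (hφ : ConvexOn ℝ Set.univ φ) (x : Fin n → ℝ) :
    ConvexOn ℝ Set.univ fun z => φ (x + z) := by
  simpa [Function.comp_def] using hφ.translate_right x

theorem exists_isSubgradient {φ : (Fin n → ℝ) → ℝ} (hφ : ConvexOn ℝ Set.univ φ)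
    (x : Fin n → ℝ) : ∃ p, IsSubgradient φ x p := by
  obtain ⟨l, hl, -⟩ := exists_linear_between (convexOn_translate hφ x)
    (convex_singleton ((0 : Fin n → ℝ), φ (x + 0))) rfl (by simp)
  refine ⟨fun j => l (Pi.single j 1), fun y => ?_⟩
  have := hl (y - x)
  rw [linearMap_apply_eq_dotProduct] at this
  simp only [add_zero, add_sub_cancel] at this
  linarith

theorem subdifferential_nonempty {f : (Fin n → ℝ) → (Fin n → ℝ)} (hf : IsConvexMap f)
    (x : Fin n → ℝ) : (subdifferential f x).Nonempty := by
  choose P hP using fun i => exists_isSubgradient (hf i) x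
  exact ⟨P, mem_subdifferential_iff.2 hP⟩

theorem IsSubgradient.nonneg {φ : (Fin n → ℝ) → ℝ} (hφ : Monotone φ) {x p : Fin n → ℝ}
    (hp : IsSubgradient φ x p) (j : Fin n) : 0 ≤ p j := by
  have h1 := hp (x - Pi.single j 1)
  have h2 : φ (x - Pi.single j 1) ≤ φ x := hφ (by simp [Pi.single_nonneg])
  have h3 : x - Pi.single j 1 - x = -Pi.single j (1 : ℝ) := by abel
  rw [h3, dotProduct_neg, dotProduct_single_one] at h1
  linarith

/-- Moving `x` by the constants `1` and `-1` bounds each row sum from both sides. -/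
theorem mem_rowStochastic_of_mem_subdifferential {f : (Fin n → ℝ) → (Fin n → ℝ)}
    (hmono : Monotone f) (hhom : IsAddHomogeneous f) {x : Fin n → ℝ}
    {P : Matrix (Fin n) (Fin n) ℝ} (hP : P ∈ subdifferential f x) :
    P ∈ rowStochastic ℝ (Fin n) := by
  rw [mem_rowStochastic_iff_sum]
  rw [mem_subdifferential_iff] at hP
  refine ⟨fun i => (hP i).nonneg fun a b h => hmono h i, fun i => ?_⟩
  have key : ∀ c : ℝ, (∑ j, P i j) * c ≤ c := by
    intro c
    have h := hP i (fun j => c + x j)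
    have h1 : ((fun j => c + x j) - x) = fun _ => c := by ext; simp
    have h2 : f (fun j => c + x j) i = c + f x i := congrFun (hhom c x) i
    simp only [h1, h2] at h
    simpa [dotProduct, Finset.sum_mul] using h
  have h1 := key 1
  have h2 := key (-1)
  linarith

/-- Chain rule, first half: a subgradient of a composite `φ ∘ f`, with `φ` nondecreasing, is
dominated by a subgradient of the outer function. -/
theorem exists_isSubgradient_of_comp {φ : (Fin n → ℝ) → ℝ} (hφ : ConvexOn ℝ Set.univ φ)
    (hmono : Monotone φ) {f : (Fin n → ℝ) → (Fin n → ℝ)} (hf : IsConvexMap f)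
    {v r : Fin n → ℝ} (hr : IsSubgradient (fun y => φ (f y)) v r) :
    ∃ p, IsSubgradient φ (f v) p ∧ ∀ y, r ⬝ᵥ (y - v) ≤ p ⬝ᵥ (f y - f v) := by
  -- The inequality in the first component makes `C` convex although `f` is not affine; monotonicity
  -- of `φ` keeps `C` below the graph.
  let C : Set ((Fin n → ℝ) × ℝ) := {z | ∃ y, f y - f v ≤ z.1 ∧ z.2 ≤ φ (f v) + r ⬝ᵥ (y - v)}
  have hC : Convex ℝ C := by
    rintro ⟨z, t⟩ ⟨y, hy1, hy2⟩ ⟨z', t'⟩ ⟨y', hy1', hy2'⟩ a b ha hb hab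
    refine ⟨a • y + b • y', fun i => ?_, ?_⟩
    · have h := (hf i).2 (Set.mem_univ y) (Set.mem_univ y') ha hb hab
      have h1 := mul_le_mul_of_nonneg_left (hy1 i) ha
      have h2 := mul_le_mul_of_nonneg_left (hy1' i) hb
      have h3 : f v i = a * f v i + b * f v i := by rw [← add_mul, hab, one_mul]
      simp only [Pi.sub_apply, smul_eq_mul, Prod.smul_mk, Prod.mk_add_mk, Pi.add_apply,
        Pi.smul_apply] at h h1 h2 ⊢
      linarith
    · have h1 := mul_le_mul_of_nonneg_left hy2 ha
      have h2 := mul_le_mul_of_nonneg_left hy2' hb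
      have h3 : a • y + b • y' - v = a • (y - v) + b • (y' - v) := by
        nth_rewrite 1 [← one_smul ℝ v]
        rw [← hab]
        module
      have h4 : φ (f v) = a * φ (f v) + b * φ (f v) := by rw [← add_mul, hab, one_mul]
      simp only [h3, dotProduct_add, dotProduct_smul, smul_eq_mul, Prod.smul_mk,
        Prod.mk_add_mk] at h1 h2 ⊢
      linarith
  have hC0 : ((0 : Fin n → ℝ), φ (f v + 0)) ∈ C := ⟨v, by simp, by simp⟩
  have hCle : ∀ z ∈ C, z.2 ≤ φ (f v + z.1) := by
    rintro ⟨z, t⟩ ⟨y, hy1, hy2⟩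
    have h1 : φ (f y) ≤ φ (f v + z) := hmono (by simpa [add_comm] using hy1)
    have h2 := hr y
    simp only at h1 h2 hy2 ⊢
    linarith
  obtain ⟨l, hl1, hl2⟩ := exists_linear_between (convexOn_translate hφ (f v)) hC hC0 hCle
  refine ⟨fun j => l (Pi.single j 1), fun y => ?_, fun y => ?_⟩
  · have := hl1 (y - f v)
    rw [linearMap_apply_eq_dotProduct] at this
    simp only [add_zero, add_sub_cancel] at this
    linarith
  · have := hl2 (f y - f v, φ (f v) + r ⬝ᵥ (y - v)) ⟨y, le_rfl, le_rfl⟩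
    rw [linearMap_apply_eq_dotProduct] at this
    simp only [add_zero] at this
    linarith

/-- Chain rule, second half: a subgradient of a nonnegative combination of the coordinates of a
convex map is the same combination of subgradients of these coordinates. -/
theorem exists_vecMul_eq_of_le {f : (Fin n → ℝ) → (Fin n → ℝ)} (hf : IsConvexMap f)
    {v p r : Fin n → ℝ} (hp : ∀ j, 0 ≤ p j)
    (hr : ∀ y, r ⬝ᵥ (y - v) ≤ p ⬝ᵥ (f y - f v)) :
    ∃ Q ∈ subdifferential f v, r = p ᵥ* Q := by
  -- Each coordinate of `f` gets its own copy of the variable. Separating `Φ` from the affine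
  -- function given by `r` on the diagonal yields a functional that splits into one part `q j` per
  -- coordinate.
  let Φ : (Fin n → Fin n → ℝ) → ℝ := fun Y => ∑ j, p j * f (v + Y j) j
  have hΦ : ConvexOn ℝ Set.univ Φ := by
    refine ⟨convex_univ, fun Y _ Z _ a b ha hb hab => ?_⟩
    simp only [Φ, smul_eq_mul, Finset.mul_sum]
    rw [← Finset.sum_add_distrib]
    refine Finset.sum_le_sum fun j _ => ?_
    have h := mul_le_mul_of_nonneg_left ((convexOn_translate (hf j) v).2 (Set.mem_univ (Y j))
      (Set.mem_univ (Z j)) ha hb hab) (hp j)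
    simp only [smul_eq_mul, Pi.add_apply, Pi.smul_apply] at h ⊢
    linarith
  have hΦ0 : Φ 0 = p ⬝ᵥ f v := by simp [Φ, dotProduct]
  let C : Set ((Fin n → Fin n → ℝ) × ℝ) := {z | ∃ y, z = (fun _ => y, Φ 0 + r ⬝ᵥ y)}
  have hC : Convex ℝ C := by
    rintro _ ⟨y, rfl⟩ _ ⟨y', rfl⟩ a b ha hb hab
    refine ⟨a • y + b • y', ?_⟩
    ext1
    · rfl
    · simp only [Prod.snd_add, Prod.smul_snd, smul_eq_mul, dotProduct_add, dotProduct_smul]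
      linear_combination Φ 0 * hab
  have hC0 : (0, Φ 0) ∈ C := ⟨0, by simp; rfl⟩
  have hCle : ∀ z ∈ C, z.2 ≤ Φ z.1 := by
    rintro _ ⟨y, rfl⟩
    have h := hr (v + y)
    have h1 : Φ (fun _ => y) = p ⬝ᵥ f (v + y) := rfl
    rw [add_sub_cancel_left, dotProduct_sub] at h
    simp only [h1, hΦ0]
    linarith
  obtain ⟨l, hl1, hl2⟩ := exists_linear_between hΦ hC hC0 hCle
  let q : Fin n → Fin n → ℝ := fun j i => l (Pi.single j (Pi.single i 1))
  have hq : ∀ j y, l (Pi.single j y) = q j ⬝ᵥ y := fun j y =>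
    linearMap_apply_eq_dotProduct (l ∘ₗ LinearMap.single ℝ (fun _ => Fin n → ℝ) j) y
  have hqle : ∀ j y, q j ⬝ᵥ y ≤ p j * (f (v + y) j - f v j) := by
    intro j y
    have h := hl1 (Pi.single j y)
    rw [hq] at h
    have h1 : Φ (Pi.single j y) - Φ 0 = p j * (f (v + y) j - f v j) := by
      simp only [Φ, ← Finset.sum_sub_distrib]
      rw [Finset.sum_eq_single j]
      · simp [mul_sub]
      · intro b _ hb
        simp [Pi.single_eq_of_ne hb]
      · simp
    linarith
  have hrl : ∀ y, r ⬝ᵥ y = ∑ j, q j ⬝ᵥ y := by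
    have hconst : ∀ y, l (fun _ => y) = ∑ j, q j ⬝ᵥ y := by
      intro y
      simp_rw [← hq, ← map_sum]
      congr 1
      exact (Finset.univ_sum_single (fun _ : Fin n => y)).symm
    intro y
    have h1 := hl2 _ ⟨y, rfl⟩
    have h2 := hl2 _ ⟨-y, rfl⟩
    simp only [hconst, dotProduct_neg, Finset.sum_neg_distrib] at h1 h2
    linarith
  obtain ⟨P, hP⟩ := subdifferential_nonempty hf v
  rw [mem_subdifferential_iff] at hP
  -- Where `p j = 0`, `hqle` at opposite vectors forces `q j = 0`, so any subgradient can fill the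
  -- row.
  refine ⟨fun j => if p j = 0 then P j else (p j)⁻¹ • q j, ?_, ?_⟩
  · refine mem_subdifferential_iff.2 fun j => ?_
    by_cases h : p j = 0
    · simpa [h] using hP j
    · intro y
      have hpos : 0 < p j := lt_of_le_of_ne (hp j) (Ne.symm h)
      have h1 := hqle j (y - v)
      rw [add_sub_cancel] at h1
      simp only [h, if_false, smul_dotProduct, smul_eq_mul]
      rwa [inv_mul_le_iff₀ hpos]
  · ext i
    have h1 := hrl (Pi.single i 1)
    simp only [dotProduct_single_one] at h1
    rw [h1]
    simp only [vecMul, dotProduct]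
    refine Finset.sum_congr rfl fun j _ => ?_
    by_cases h : p j = 0
    · have h2 := hqle j (Pi.single i 1)
      have h3 := hqle j (-Pi.single i 1)
      simp only [h, dotProduct_neg, dotProduct_single_one, zero_mul] at h2 h3 ⊢
      linarith
    · simp [h]

/-- Chain rule for subgradients of a composite `φ ∘ f` with `φ` nondecreasing. -/
theorem exists_vecMul_of_isSubgradient_comp {φ : (Fin n → ℝ) → ℝ} (hφ : ConvexOn ℝ Set.univ φ)
    (hmono : Monotone φ) {f : (Fin n → ℝ) → (Fin n → ℝ)} (hf : IsConvexMap f)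
    {v r : Fin n → ℝ} (hr : IsSubgradient (fun y => φ (f y)) v r) :
    ∃ p, IsSubgradient φ (f v) p ∧ ∃ Q ∈ subdifferential f v, r = p ᵥ* Q := by
  obtain ⟨p, hp, h⟩ := exists_isSubgradient_of_comp hφ hmono hf hr
  exact ⟨p, hp, exists_vecMul_eq_of_le hf (hp.nonneg hmono) h⟩

/-! ### Invariant measures of stochastic matrices -/

section Stochastic

variable {n : ℕ} {P : Matrix (Fin n) (Fin n) ℝ} {m : Fin n → ℝ}

/-- `m` is a (not necessarily normalized) invariant measure of the matrix `P`. -/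
structure IsInvariant (m : Fin n → ℝ) (P : Matrix (Fin n) (Fin n) ℝ) : Prop where
  nonneg : ∀ i, 0 ≤ m i
  vecMul_eq : m ᵥ* P = m

theorem IsInvariant.sum_eq (hm : IsInvariant m P) (b : Fin n) : ∑ a, m a * P a b = m b :=
  congrFun hm.vecMul_eq b

theorem IsInvariant.pow (hm : IsInvariant m P) (k : ℕ) : IsInvariant m (P ^ k) := by
  refine ⟨hm.nonneg, ?_⟩
  induction k with
  | zero => simp
  | succ k ih => rw [pow_succ, ← vecMul_vecMul, ih, hm.vecMul_eq]

theorem IsInvariant.pos_of_ne_zero (hP : P ∈ rowStochastic ℝ (Fin n)) (hm : IsInvariant m P)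
    {a b : Fin n} (ha : 0 < m a) (hab : P a b ≠ 0) : 0 < m b := by
  rw [← hm.sum_eq b]
  exact Finset.sum_pos' (fun i _ => mul_nonneg (hm.nonneg i) (nonneg_of_mem_rowStochastic hP))
    ⟨a, Finset.mem_univ a,
      mul_pos ha (lt_of_le_of_ne (nonneg_of_mem_rowStochastic hP) hab.symm)⟩

/-- An invariant measure does not flow into a closed set of nodes from outside. -/
theorem IsInvariant.mul_eq_zero_of_closed (hP : P ∈ rowStochastic ℝ (Fin n))
    (hm : IsInvariant m P) {S : Set (Fin n)} (hS : ∀ a ∈ S, ∀ b, P a b ≠ 0 → b ∈ S)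
    {a b : Fin n} (ha : a ∉ S) (hb : b ∈ S) : m a * P a b = 0 := by
  classical
  let s : Finset (Fin n) := Finset.univ.filter (· ∈ S)
  have hrow : ∀ c ∈ s, ∑ d ∈ s, P c d = 1 := by
    intro c hc
    rw [← sum_row_of_mem_rowStochastic hP c]
    refine Finset.sum_subset (Finset.subset_univ s) fun d _ hd => ?_
    by_contra h
    exact hd (by simpa [s] using hS c (by simpa [s] using hc) d h)
  -- The mass arriving in `S` is all the mass of `S`, which never leaves, plus the inflow; by
  -- invariance it is the mass of `S`, so the inflow is zero.
  have hflow : ∑ d ∈ s, ∑ c, m c * P c d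
      = ∑ c ∈ s, m c + ∑ c ∈ sᶜ, ∑ d ∈ s, m c * P c d := by
    rw [Finset.sum_comm, ← Finset.sum_add_sum_compl s]
    congr 1
    refine Finset.sum_congr rfl fun c hc => ?_
    rw [← Finset.mul_sum, hrow c hc, mul_one]
  have hzero : ∑ c ∈ sᶜ, ∑ d ∈ s, m c * P c d = 0 := by
    simp only [hm.sum_eq] at hflow
    linarith
  have hnn : ∀ c d, 0 ≤ m c * P c d := fun c d =>
    mul_nonneg (hm.nonneg c) (nonneg_of_mem_rowStochastic hP)
  rw [Finset.sum_eq_zero_iff_of_nonneg fun c _ => Finset.sum_nonneg fun d _ => hnn c d] at hzero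
  have h1 := hzero a (by simpa [s] using ha)
  rw [Finset.sum_eq_zero_iff_of_nonneg fun d _ => hnn a d] at h1
  exact h1 b (by simpa [s] using hb)

/-- Recurrence: the nodes accessible from `b` form a closed set, so a charged arc `a → b` with `a`
outside it would be a forbidden inflow. -/
theorem IsInvariant.hasAccess_symm (hP : P ∈ rowStochastic ℝ (Fin n)) (hm : IsInvariant m P)
    {i j : Fin n} (hi : 0 < m i) (hij : (matrixGraph P).HasAccess i j) :
    0 < m j ∧ (matrixGraph P).HasAccess j i := by
  induction hij with
  | refl => exact ⟨hi, .refl⟩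
  | @tail a b _ hab ih =>
    refine ⟨hm.pos_of_ne_zero hP ih.1 hab, ?_⟩
    refine Relation.ReflTransGen.trans (b := a) ?_ ih.2
    by_contra h
    have := hm.mul_eq_zero_of_closed hP (S := {c | (matrixGraph P).HasAccess b c})
      (fun c hc d hcd => Relation.ReflTransGen.tail hc hcd) h Relation.ReflTransGen.refl
    exact mul_ne_zero ih.1.ne' hab this

theorem IsInvariant.exists_finalClass (hP : P ∈ rowStochastic ℝ (Fin n)) (hm : IsInvariant m P)
    {i : Fin n} (hi : 0 < m i) :
    ∃ C ∈ (matrixGraph P).finalClasses, i ∈ C ∧ ∀ j, P i j ≠ 0 → j ∈ C := by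
  have key : ∀ j, (matrixGraph P).HasAccess i j → (matrixGraph P).HasAccess j i :=
    fun j hj => (hm.hasAccess_symm hP hi hj).2
  refine ⟨_, ⟨⟨i, Set.mem_univ i, rfl⟩, ?_⟩, ⟨Set.mem_univ i, .refl, .refl⟩, fun j hj => ?_⟩
  · rintro a ⟨-, ha, -⟩ j - haj
    have : (matrixGraph P).HasAccess i j := Relation.ReflTransGen.trans ha haj
    exact ⟨Set.mem_univ j, this, key j this⟩
  · have : (matrixGraph P).HasAccess i j := .single hj
    exact ⟨Set.mem_univ j, this, key j this⟩

/-- Since `P` fixes the constants it has a nonzero left fixed vector `x`; `|x| ≤ |x| P` entrywise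
with equal total masses, hence equality. -/
theorem exists_isInvariant [Nonempty (Fin n)] (hP : P ∈ rowStochastic ℝ (Fin n)) :
    ∃ m, IsInvariant m P ∧ ∃ a, 0 < m a := by
  have hdet : (P - 1).det = 0 := exists_mulVec_eq_zero_iff.1
    ⟨1, one_ne_zero, by rw [sub_mulVec, one_vecMul_of_mem_rowStochastic hP, one_mulVec, sub_self]⟩
  obtain ⟨x, hx0, hx⟩ := exists_vecMul_eq_zero_iff.2 hdet
  rw [vecMul_sub, vecMul_one, sub_eq_zero] at hx
  have hle : ∀ b ∈ Finset.univ, |x b| ≤ ∑ a, |x a| * P a b := by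
    intro b _
    calc |x b| = |∑ a, x a * P a b| := by rw [← congrFun hx b]; rfl
      _ ≤ ∑ a, |x a * P a b| := Finset.abs_sum_le_sum_abs _ _
      _ = ∑ a, |x a| * P a b := by
        simp only [abs_mul, abs_of_nonneg (nonneg_of_mem_rowStochastic hP)]
  have hsum : ∑ b, |x b| = ∑ b, ∑ a, |x a| * P a b := by
    rw [Finset.sum_comm]
    simp only [← Finset.mul_sum, sum_row_of_mem_rowStochastic hP, mul_one]
  refine ⟨fun a => |x a|, ⟨fun a => abs_nonneg _, ?_⟩, ?_⟩
  · ext b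
    exact ((Finset.sum_eq_sum_iff_of_le hle).1 hsum b (Finset.mem_univ b)).symm
  · obtain ⟨a, ha⟩ := Function.ne_iff.1 hx0
    exact ⟨a, abs_pos.2 ha⟩

/-- Each final class of a stochastic matrix is charged by some invariant measure. -/
theorem exists_isInvariant_of_finalClass (hP : P ∈ rowStochastic ℝ (Fin n)) {C : Set (Fin n)}
    (hC : C ∈ (matrixGraph P).finalClasses) : ∃ m, IsInvariant m P ∧ ∀ a ∈ C, 0 < m a := by
  classical
  obtain ⟨⟨i, -, hCi⟩, hfin⟩ := hC
  have hi : i ∈ C := by rw [hCi]; exact ⟨Set.mem_univ i, .refl, .refl⟩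
  have hacc : ∀ a ∈ C, ∀ b ∈ C, (matrixGraph P).HasAccess a b := by
    intro a ha b hb
    rw [hCi] at ha hb
    exact Relation.ReflTransGen.trans ha.2.2 hb.2.1
  have hclosed : ∀ a ∈ C, ∀ b, P a b ≠ 0 → b ∈ C := fun a ha b hab =>
    hfin a ha b (Set.mem_univ b) (.single hab)
  -- Redirect all the nodes outside `C` to `i`.
  let Q : Matrix (Fin n) (Fin n) ℝ := Matrix.of fun a => if a ∈ C then P a else Pi.single i 1
  have hQC : ∀ a ∈ C, ∀ b, Q a b = P a b := fun a ha b => by simp [Q, ha]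
  have hQC' : ∀ a, a ∉ C → ∀ b, Q a b = (Pi.single i 1 : Fin n → ℝ) b :=
    fun a ha b => by simp [Q, ha]
  have hQ : Q ∈ rowStochastic ℝ (Fin n) := by
    rw [mem_rowStochastic_iff_sum]
    refine ⟨fun a b => ?_, fun a => ?_⟩
    · by_cases ha : a ∈ C
      · rw [hQC a ha]
        exact nonneg_of_mem_rowStochastic hP
      · rw [hQC' a ha]
        exact (Pi.single_nonneg (α := fun _ : Fin n => ℝ)).2 zero_le_one b
    · by_cases ha : a ∈ C
      · simp only [hQC a ha, sum_row_of_mem_rowStochastic hP]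
      · simp only [hQC' a ha, Finset.sum_pi_single', Finset.mem_univ, if_true]
  have : Nonempty (Fin n) := ⟨i⟩
  obtain ⟨m, hm, a, ha⟩ := exists_isInvariant hQ
  -- Every arc of `Q` ends in `C`, so `m` lives on `C`, where `Q` and `P` have the same rows.
  have hoff : ∀ b, b ∉ C → m b = 0 := by
    intro b hb
    rw [← hm.sum_eq b]
    refine Finset.sum_eq_zero fun c _ => ?_
    by_cases hc : c ∈ C
    · rw [hQC c hc]
      by_cases h : P c b = 0
      · rw [h, mul_zero]
      · exact absurd (hclosed c hc b h) hb
    · rw [hQC' c hc, Pi.single_eq_of_ne (fun h => hb (by rw [h]; exact hi)), mul_zero]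
  have hmP : IsInvariant m P := by
    refine ⟨hm.nonneg, ?_⟩
    ext b
    rw [← hm.sum_eq b]
    change ∑ c, m c * P c b = ∑ c, m c * Q c b
    refine Finset.sum_congr rfl fun c _ => ?_
    by_cases hc : c ∈ C
    · rw [hQC c hc]
    · rw [hoff c hc, zero_mul, zero_mul]
  have haC : a ∈ C := by
    by_contra h
    exact ha.ne' (hoff a h)
  exact ⟨m, hmP, fun b hb => (hmP.hasAccess_symm hP ha (hacc a haC b hb)).1⟩

end Stochastic

/-! ### The critical graph in terms of invariant measures -/

section CriticalGraph

variable {n : ℕ} {f : (Fin n → ℝ) → (Fin n → ℝ)} {v w : Fin n → ℝ}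

theorem mem_criticalGraph_nodes_iff (hmono : Monotone f) (hhom : IsAddHomogeneous f)
    {i : Fin n} : i ∈ (criticalGraph f v).nodes ↔
      ∃ P ∈ subdifferential f v, ∃ m, IsInvariant m P ∧ 0 < m i := by
  constructor
  · rintro ⟨_, ⟨P, hP, rfl⟩, _, ⟨C, hC, rfl⟩, -, hi⟩
    obtain ⟨m, hm, hpos⟩ := exists_isInvariant_of_finalClass
      (mem_rowStochastic_of_mem_subdifferential hmono hhom hP) hC
    exact ⟨P, hP, m, hm, hpos i hi⟩
  · rintro ⟨P, hP, m, hm, hi⟩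
    obtain ⟨C, hC, hiC, -⟩ := hm.exists_finalClass
      (mem_rowStochastic_of_mem_subdifferential hmono hhom hP) hi
    exact ⟨_, ⟨P, hP, rfl⟩, _, ⟨C, hC, rfl⟩, Set.mem_univ i, hiC⟩

theorem criticalGraph_arc_iff (hmono : Monotone f) (hhom : IsAddHomogeneous f)
    {i j : Fin n} : (criticalGraph f v).Arc i j ↔
      ∃ P ∈ subdifferential f v, ∃ m, IsInvariant m P ∧ 0 < m i ∧ P i j ≠ 0 := by
  constructor
  · rintro ⟨_, ⟨P, hP, rfl⟩, _, ⟨C, hC, rfl⟩, hij, hi, -⟩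
    obtain ⟨m, hm, hpos⟩ := exists_isInvariant_of_finalClass
      (mem_rowStochastic_of_mem_subdifferential hmono hhom hP) hC
    exact ⟨P, hP, m, hm, hpos i hi, hij⟩
  · rintro ⟨P, hP, m, hm, hi, hij⟩
    obtain ⟨C, hC, hiC, hC'⟩ := hm.exists_finalClass
      (mem_rowStochastic_of_mem_subdifferential hmono hhom hP) hi
    exact ⟨_, ⟨P, hP, rfl⟩, _, ⟨C, hC, rfl⟩, hij, hiC, hC' j hij⟩

/-- A row of sum one cannot vanish. Hence a family indexed by critical arcs also accounts for all
critical nodes. -/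
theorem exists_arc_of_mem_nodes (hmono : Monotone f) (hhom : IsAddHomogeneous f)
    {i : Fin n} (hi : i ∈ (criticalGraph f v).nodes) : ∃ j, (criticalGraph f v).Arc i j := by
  obtain ⟨P, hP, m, hm, hmi⟩ := (mem_criticalGraph_nodes_iff hmono hhom).1 hi
  by_contra! h
  have hzero : ∀ j, P i j = 0 := fun j => by
    by_contra hj
    exact h j ((criticalGraph_arc_iff hmono hhom).2 ⟨P, hP, m, hm, hmi, hj⟩)
  have := sum_row_of_mem_rowStochastic (mem_rowStochastic_of_mem_subdifferential hmono hhom hP) i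
  simp [hzero] at this

/-! ### Independence of the eigenvector -/

/-- Defect of the subgradient inequality between two eigenvectors, integrated against an invariant
measure. -/
theorem sum_mul_defect_eq {P : Matrix (Fin n) (Fin n) ℝ} {m : Fin n → ℝ} (hm : IsInvariant m P)
    {c d : ℝ} (hv : f v = fun i => c + v i) (hw : f w = fun i => d + w i) :
    ∑ i, m i * (f w i - f v i - P i ⬝ᵥ (w - v)) = (d - c) * ∑ i, m i := by
  have h : ∑ i, m i * (P i ⬝ᵥ (w - v)) = ∑ i, m i * (w i - v i) := by
    change m ⬝ᵥ (P *ᵥ (w - v)) = m ⬝ᵥ (w - v)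
    rw [dotProduct_mulVec, hm.vecMul_eq]
  calc ∑ i, m i * (f w i - f v i - P i ⬝ᵥ (w - v))
      = ∑ i, ((d - c) * m i + m i * (w i - v i)) - ∑ i, m i * (P i ⬝ᵥ (w - v)) := by
        rw [← Finset.sum_sub_distrib]
        refine Finset.sum_congr rfl fun i _ => ?_
        rw [hv, hw]
        ring
    _ = (d - c) * ∑ i, m i := by
        rw [Finset.sum_add_distrib, h, add_sub_cancel_right, Finset.mul_sum]

theorem eigenvalue_le {P : Matrix (Fin n) (Fin n) ℝ} (hP : P ∈ subdifferential f v)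
    {m : Fin n → ℝ} (hm : IsInvariant m P) {a : Fin n} (ha : 0 < m a) {c d : ℝ}
    (hv : f v = fun i => c + v i) (hw : f w = fun i => d + w i) : c ≤ d := by
  have h1 := sum_mul_defect_eq hm hv hw
  have h2 : 0 ≤ ∑ i, m i * (f w i - f v i - P i ⬝ᵥ (w - v)) := Finset.sum_nonneg fun i _ =>
    mul_nonneg (hm.nonneg i) (sub_nonneg.2 (hP w i))
  have h3 : 0 < ∑ i, m i := Finset.sum_pos' (fun i _ => hm.nonneg i) ⟨a, Finset.mem_univ a, ha⟩
  rw [h1] at h2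
  exact sub_nonneg.1 (nonneg_of_mul_nonneg_left h2 h3)

/-- The two eigenvalues agree, so the nonnegative weighted defects sum to zero and the inequality at
`v` is tight at `w` on the support of `m`. There the rows of `P` remain subgradients; the other rows
are invisible to `m` and may be replaced. -/
theorem exists_subdifferential_of_eigenvectors (hconv : IsConvexMap f) (hmono : Monotone f)
    (hhom : IsAddHomogeneous f) (hv : IsEigenvector f v) (hw : IsEigenvector f w)
    {P : Matrix (Fin n) (Fin n) ℝ} (hP : P ∈ subdifferential f v)
    {m : Fin n → ℝ} (hm : IsInvariant m P) {a : Fin n} (ha : 0 < m a) :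
    ∃ Q ∈ subdifferential f w, IsInvariant m Q ∧ ∀ i, 0 < m i → Q i = P i := by
  classical
  obtain ⟨c, hc⟩ := hv
  obtain ⟨d, hd⟩ := hw
  obtain ⟨R, hR⟩ := subdifferential_nonempty hconv w
  have : Nonempty (Fin n) := ⟨a⟩
  obtain ⟨m', hm', b, hb⟩ :=
    exists_isInvariant (mem_rowStochastic_of_mem_subdifferential hmono hhom hR)
  have hcd : c = d := le_antisymm (eigenvalue_le hP hm ha hc hd) (eigenvalue_le hR hm' hb hd hc)
  have hdef := sum_mul_defect_eq hm hc hd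
  have hnn : ∀ i ∈ Finset.univ, 0 ≤ m i * (f w i - f v i - P i ⬝ᵥ (w - v)) := fun i _ =>
    mul_nonneg (hm.nonneg i) (sub_nonneg.2 (hP w i))
  rw [hcd, sub_self, zero_mul, Finset.sum_eq_zero_iff_of_nonneg hnn] at hdef
  let Q : Matrix (Fin n) (Fin n) ℝ := Matrix.of fun i => if 0 < m i then P i else R i
  have hQ1 : ∀ i, 0 < m i → Q i = P i := fun i hi => by ext j; simp [Q, hi]
  have hQ2 : ∀ i, ¬ 0 < m i → Q i = R i := fun i hi => by ext j; simp [Q, hi]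
  refine ⟨Q, mem_subdifferential_iff.2 fun i => ?_, ⟨hm.nonneg, ?_⟩, hQ1⟩
  · by_cases hi : 0 < m i
    · rw [hQ1 i hi]
      intro y
      have h1 := (mul_eq_zero.1 (hdef i (Finset.mem_univ i))).resolve_left hi.ne'
      have h2 := mem_subdifferential_iff.1 hP i y
      have h3 : y - v = (y - w) + (w - v) := by abel
      rw [h3, dotProduct_add] at h2
      linarith
    · rw [hQ2 i hi]
      exact mem_subdifferential_iff.1 hR i
  · nth_rewrite 2 [← hm.vecMul_eq]
    ext b
    change ∑ i, m i * Q i b = ∑ i, m i * P i b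
    refine Finset.sum_congr rfl fun i _ => ?_
    by_cases hi : 0 < m i
    · rw [hQ1 i hi]
    · rw [le_antisymm (not_lt.1 hi) (hm.nonneg i), zero_mul, zero_mul]

theorem criticalGraph_congr (hconv : IsConvexMap f) (hmono : Monotone f)
    (hhom : IsAddHomogeneous f) (hv : IsEigenvector f v) (hw : IsEigenvector f w) :
    criticalGraph f v = criticalGraph f w := by
  have hnodes : ∀ {v w}, IsEigenvector f v → IsEigenvector f w →
      ∀ i, i ∈ (criticalGraph f v).nodes → i ∈ (criticalGraph f w).nodes := by
    intro v w hv hw i hi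
    obtain ⟨P, hP, m, hm, hmi⟩ := (mem_criticalGraph_nodes_iff hmono hhom).1 hi
    obtain ⟨Q, hQ, hmQ, -⟩ :=
      exists_subdifferential_of_eigenvectors hconv hmono hhom hv hw hP hm hmi
    exact (mem_criticalGraph_nodes_iff hmono hhom).2 ⟨Q, hQ, m, hmQ, hmi⟩
  have harc : ∀ {v w}, IsEigenvector f v → IsEigenvector f w →
      ∀ i j, (criticalGraph f v).Arc i j → (criticalGraph f w).Arc i j := by
    intro v w hv hw i j hij
    obtain ⟨P, hP, m, hm, hmi, hPij⟩ := (criticalGraph_arc_iff hmono hhom).1 hij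
    obtain ⟨Q, hQ, hmQ, hQP⟩ :=
      exists_subdifferential_of_eigenvectors hconv hmono hhom hv hw hP hm hmi
    exact (criticalGraph_arc_iff hmono hhom).2 ⟨Q, hQ, m, hmQ, hmi, by rwa [hQP i hmi]⟩
  refine NodeDigraph.ext (Set.ext fun i => ⟨hnodes hv hw i, hnodes hw hv i⟩) ?_
  ext i j
  exact ⟨harc hv hw i j, harc hw hv i j⟩

/-! ### Mixtures of subgradients -/

/-- A family of measures and subgradients whose total mass is globally conserved can be mixed into a
single subgradient with an invariant measure. -/
theorem exists_mixture (hconv : IsConvexMap f) (hmono : Monotone f) (hhom : IsAddHomogeneous f)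
    {S : Type*} [Fintype S] {μ : S → Fin n → ℝ} (hμ : ∀ s a, 0 ≤ μ s a)
    {K : S → Matrix (Fin n) (Fin n) ℝ} (hK : ∀ s, K s ∈ subdifferential f v)
    (hbal : ∑ s, μ s ᵥ* K s = ∑ s, μ s) :
    ∃ P ∈ subdifferential f v, ∃ m, IsInvariant m P ∧ ∀ s a, 0 < μ s a →
      0 < m a ∧ ∀ b, K s a b ≠ 0 → P a b ≠ 0 := by
  classical
  obtain ⟨R, hR⟩ := subdifferential_nonempty hconv v
  let m : Fin n → ℝ := fun a => ∑ s, μ s a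
  have hm0 : ∀ a, 0 ≤ m a := fun a => Finset.sum_nonneg fun s _ => hμ s a
  have hmpos : ∀ s a, 0 < μ s a → 0 < m a := fun s a h =>
    Finset.sum_pos' (fun s _ => hμ s a) ⟨s, Finset.mem_univ s, h⟩
  -- Row `a` averages the rows `K s a` with weights `μ s a / m a`; all entries are nonnegative, so
  -- no arc is lost by cancellation.
  let P : Matrix (Fin n) (Fin n) ℝ :=
    Matrix.of fun a b => if m a = 0 then R a b else (m a)⁻¹ * ∑ s, μ s a * K s a b
  have hP1 : ∀ a, m a ≠ 0 → ∀ b, P a b = (m a)⁻¹ * ∑ s, μ s a * K s a b :=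
    fun a ha b => by simp [P, ha]
  have hP2 : ∀ a, m a = 0 → P a = R a := fun a ha => by ext b; simp [P, ha]
  refine ⟨P, mem_subdifferential_iff.2 fun a => ?_, m, ⟨hm0, ?_⟩, fun s a hs =>
    ⟨hmpos s a hs, fun b hb => ?_⟩⟩
  · by_cases ha : m a = 0
    · rw [hP2 a ha]
      exact mem_subdifferential_iff.1 hR a
    · intro y
      have hpos : 0 < m a := lt_of_le_of_ne (hm0 a) (Ne.symm ha)
      have h1 : P a ⬝ᵥ (y - v) = (m a)⁻¹ * ∑ s, μ s a * (K s a ⬝ᵥ (y - v)) := by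
        simp only [dotProduct, hP1 a ha, Finset.mul_sum, Finset.sum_mul]
        rw [Finset.sum_comm]
        exact Finset.sum_congr rfl fun s _ => Finset.sum_congr rfl fun b _ => by ring
      rw [h1, inv_mul_le_iff₀ hpos, Finset.sum_mul]
      exact Finset.sum_le_sum fun s _ => mul_le_mul_of_nonneg_left
        (mem_subdifferential_iff.1 (hK s) a y) (hμ s a)
  · ext b
    have h1 : ∀ a, m a * P a b = ∑ s, μ s a * K s a b := by
      intro a
      by_cases ha : m a = 0
      · have h2 : ∀ s, μ s a = 0 := fun s =>
          (Finset.sum_eq_zero_iff_of_nonneg fun s _ => hμ s a).1 ha s (Finset.mem_univ s)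
        simp [ha, h2]
      · rw [hP1 a ha, mul_inv_cancel_left₀ ha]
    have h3 := congrFun hbal b
    rw [Finset.sum_apply, Finset.sum_apply] at h3
    change ∑ a, m a * P a b = ∑ s, μ s b
    rw [← h3]
    simp only [h1, vecMul, dotProduct]
    exact Finset.sum_comm
  · rw [hP1 a (hmpos s a hs).ne']
    have hnn : ∀ s, 0 ≤ K s a b := fun s => nonneg_of_mem_rowStochastic
      (mem_rowStochastic_of_mem_subdifferential hmono hhom (hK s))
    refine mul_ne_zero (inv_ne_zero (hmpos s a hs).ne') (ne_of_gt ?_)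
    exact Finset.sum_pos' (fun s _ => mul_nonneg (hμ s a) (hnn s))
      ⟨s, Finset.mem_univ s, mul_pos hs (lt_of_le_of_ne (hnn s) hb.symm)⟩

/-- A single subgradient realizes the whole critical graph. -/
theorem exists_maximal_subgradient (hconv : IsConvexMap f) (hmono : Monotone f)
    (hhom : IsAddHomogeneous f) (v : Fin n → ℝ) :
    ∃ P ∈ subdifferential f v, ∃ m, IsInvariant m P ∧
      (∀ i ∈ (criticalGraph f v).nodes, 0 < m i) ∧
      ∀ i j, (criticalGraph f v).Arc i j → P i j ≠ 0 := by
  classical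
  have key : ∀ s : {x : Fin n × Fin n // (criticalGraph f v).Arc x.1 x.2},
      ∃ P ∈ subdifferential f v, ∃ m, IsInvariant m P ∧ 0 < m s.1.1 ∧ P s.1.1 s.1.2 ≠ 0 :=
    fun s => (criticalGraph_arc_iff hmono hhom).1 s.2
  choose K hK μ hμ hpos hne using key
  obtain ⟨P, hP, m, hm, h⟩ := exists_mixture hconv hmono hhom (fun s => (hμ s).nonneg) hK
    (Finset.sum_congr rfl fun s _ => (hμ s).vecMul_eq)
  refine ⟨P, hP, m, hm, fun i hi => ?_, fun i j hij => ?_⟩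
  · obtain ⟨j, hij⟩ := exists_arc_of_mem_nodes hmono hhom hi
    exact (h ⟨(i, j), hij⟩ i (hpos _)).1
  · exact (h ⟨(i, j), hij⟩ i (hpos _)).2 j (hne _)

end CriticalGraph

/-! ### Iterates -/

section Iterates

variable {n : ℕ} {f : (Fin n → ℝ) → (Fin n → ℝ)} {v : Fin n → ℝ}

theorem IsAddHomogeneous.iterate (hhom : IsAddHomogeneous f) (k : ℕ) :
    IsAddHomogeneous f^[k] := by
  induction k with
  | zero => exact fun c x => rfl
  | succ k ih =>
    intro c x
    rw [Function.iterate_succ_apply, Function.iterate_succ_apply, hhom, ih]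

theorem IsConvexMap.iterate (hconv : IsConvexMap f) (hmono : Monotone f) (k : ℕ) :
    IsConvexMap f^[k] := by
  induction k with
  | zero =>
    exact fun i => (LinearMap.proj (R := ℝ) (φ := fun _ : Fin n => ℝ) i).convexOn convex_univ
  | succ k ih =>
    intro i
    refine ⟨convex_univ, fun x _ y _ a b ha hb hab => ?_⟩
    have h1 : f (a • x + b • y) ≤ a • f x + b • f y := fun j =>
      (hconv j).2 (Set.mem_univ x) (Set.mem_univ y) ha hb hab
    have h2 := (ih i).2 (Set.mem_univ (f x)) (Set.mem_univ (f y)) ha hb hab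
    simp only [Function.iterate_succ_apply]
    exact (hmono.iterate k h1 i).trans h2

theorem IsEigenvector.iterate (hhom : IsAddHomogeneous f) (hv : IsEigenvector f v) (k : ℕ) :
    IsEigenvector f^[k] v := by
  obtain ⟨c, hc⟩ := hv
  induction k with
  | zero => exact ⟨0, by simp⟩
  | succ k ih =>
    obtain ⟨d, hd⟩ := ih
    refine ⟨c + d, ?_⟩
    rw [Function.iterate_succ_apply, hc, hhom.iterate k, hd]
    ext i
    ring

/-- The subgradients at `x` of a coordinate of an additively homogeneous map are not changed when a
constant is added to `x`. -/
theorem IsAddHomogeneous.isSubgradient_add_iff (hhom : IsAddHomogeneous f) (i : Fin n) (c : ℝ)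
    {p : Fin n → ℝ} : IsSubgradient (fun y => f y i) (fun j => c + v j) p ↔
      IsSubgradient (fun y => f y i) v p := by
  have hf : ∀ (a : ℝ) x, f (fun j => a + x j) i = a + f x i := fun a x => congrFun (hhom a x) i
  constructor
  · intro h y
    have := h fun j => c + y j
    have hd : ((fun j => c + y j) - fun j => c + v j) = y - v := by ext; simp
    simp only [hd, hf] at this
    simpa using this
  · intro h y
    have := h fun j => -c + y j
    have hd : ((fun j => -c + y j) - v) = y - fun j => c + v j := by ext; simp; ring
    simp only [hd, hf] at this ⊢
    linarith

theorem IsAddHomogeneous.isSubgradient_eigenvector_iff {g : (Fin n → ℝ) → (Fin n → ℝ)}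
    (hg : IsAddHomogeneous g) (hv : IsEigenvector f v) (i : Fin n) {p : Fin n → ℝ} :
    IsSubgradient (fun y => g y i) (f v) p ↔ IsSubgradient (fun y => g y i) v p := by
  obtain ⟨c, hc⟩ := hv
  rw [hc]
  exact hg.isSubgradient_add_iff i c

/-- Since `f v` differs from `v` by a constant, `P ^ k` is also a subgradient of `f^[k]` at `f v`;
nonnegativity of `P ^ k` lets it be applied to the inequality for `P`. -/
theorem pow_mem_subdifferential_iterate (hmono : Monotone f)
    (hhom : IsAddHomogeneous f) (hv : IsEigenvector f v) {P : Matrix (Fin n) (Fin n) ℝ}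
    (hP : P ∈ subdifferential f v) (k : ℕ) : P ^ k ∈ subdifferential f^[k] v := by
  induction k with
  | zero => intro y; simp
  | succ k ih =>
    refine mem_subdifferential_iff.2 fun i y => ?_
    have h1 := ((hhom.iterate k).isSubgradient_eigenvector_iff hv i).2
      (mem_subdifferential_iff.1 ih i) (f y)
    have hnn : ∀ j, 0 ≤ (P ^ k) i j := fun j => nonneg_of_mem_rowStochastic
      (Submonoid.pow_mem _ (mem_rowStochastic_of_mem_subdifferential hmono hhom hP) k)
    have h2 : (P ^ (k + 1)) i ⬝ᵥ (y - v) = (P ^ k) i ⬝ᵥ (P *ᵥ (y - v)) := by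
      change (P ^ (k + 1) *ᵥ (y - v)) i = (P ^ k *ᵥ (P *ᵥ (y - v))) i
      rw [mulVec_mulVec, pow_succ]
    simp only [Function.iterate_succ_apply] at h1 ⊢
    rw [h2]
    exact (dotProduct_le_dotProduct_of_nonneg_left (hP y) hnn).trans h1

/-- The law at time `t` of the inhomogeneous Markov chain with initial law `μ` and transition
matrices `K 0, K 1, …`. -/
def chainLaw (K : ℕ → Matrix (Fin n) (Fin n) ℝ) (μ : Fin n → ℝ) : ℕ → Fin n → ℝ
  | 0 => μ
  | t + 1 => chainLaw K μ t ᵥ* K t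

theorem chainLaw_congr {K L : ℕ → Matrix (Fin n) (Fin n) ℝ} {μ : Fin n → ℝ} {t : ℕ}
    (h : ∀ s < t, K s = L s) : chainLaw K μ t = chainLaw L μ t := by
  induction t with
  | zero => rfl
  | succ t ih =>
    rw [chainLaw, chainLaw, h t t.lt_succ_self, ih fun s hs => h s (hs.trans t.lt_succ_self)]

theorem chainLaw_nonneg {K : ℕ → Matrix (Fin n) (Fin n) ℝ} {μ : Fin n → ℝ}
    (hK : ∀ t, K t ∈ rowStochastic ℝ (Fin n)) (hμ : ∀ a, 0 ≤ μ a) (t : ℕ) :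
    ∀ a, 0 ≤ chainLaw K μ t a := by
  induction t with
  | zero => exact hμ
  | succ t ih => exact nonneg_vecMul_of_mem_rowStochastic (hK t) ih

/-- Chain rule for iterates: a subgradient of a coordinate of `f^[k]` at an eigenvector is the law at
time `k` of a Markov chain whose transition matrices are subgradients of `f`. -/
theorem exists_chainLaw_eq (hconv : IsConvexMap f) (hmono : Monotone f)
    (hhom : IsAddHomogeneous f) (hv : IsEigenvector f v) (i : Fin n) (k : ℕ) :
    ∀ {r : Fin n → ℝ}, IsSubgradient (fun y => f^[k] y i) v r →
      ∃ K : ℕ → Matrix (Fin n) (Fin n) ℝ, (∀ t, K t ∈ subdifferential f v) ∧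
        r = chainLaw K (Pi.single i 1) k := by
  induction k with
  | zero =>
    intro r hr
    obtain ⟨R, hR⟩ := subdifferential_nonempty hconv v
    refine ⟨fun _ => R, fun _ => hR, ?_⟩
    have key : ∀ z, r ⬝ᵥ z ≤ z i := by
      intro z
      have := hr (v + z)
      simpa using this
    ext j
    have h1 := key (Pi.single j 1)
    have h2 := key (-Pi.single j 1)
    simp only [dotProduct_neg, dotProduct_single_one, Pi.neg_apply] at h1 h2
    rw [chainLaw, Pi.single_comm]
    linarith
  | succ k ih =>
    intro r hr
    obtain ⟨p, hp, Q, hQ, rfl⟩ := exists_vecMul_of_isSubgradient_comp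
      (φ := fun y => f^[k] y i) (hconv.iterate hmono k i) (fun a b h => hmono.iterate k h i) hconv hr
    obtain ⟨K, hK, rfl⟩ := ih (((hhom.iterate k).isSubgradient_eigenvector_iff hv i).1 hp)
    -- The innermost `f` contributes the last transition, at time `k`.
    refine ⟨Function.update K k Q, fun t => ?_, ?_⟩
    · by_cases h : t = k
      · subst h
        simpa using hQ
      · simpa [Function.update_of_ne h] using hK t
    · rw [chainLaw, Function.update_self]
      congr 1
      exact chainLaw_congr fun s hs => (Function.update_of_ne hs.ne _ _).symm

/-- Flow conservation along a Markov chain that starts from `m` and returns to `m` at time `k`. -/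
theorem sum_chainLaw_succ_eq {R : Matrix (Fin n) (Fin n) ℝ} {m : Fin n → ℝ}
    (hm : IsInvariant m R) {k : ℕ} {K : Fin n → ℕ → Matrix (Fin n) (Fin n) ℝ}
    (hK : ∀ i, R i = chainLaw (K i) (Pi.single i 1) k) :
    ∑ s : Fin n × Fin k, (m s.1 • chainLaw (K s.1) (Pi.single s.1 1) s.2) ᵥ* K s.1 s.2
      = ∑ s : Fin n × Fin k, m s.1 • chainLaw (K s.1) (Pi.single s.1 1) s.2 := by
  -- Both sides sum the laws at times `0, …, k`: the point mass is the law at time `0`, and `R i`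
  -- the law at time `k`.
  have h1 : ∀ i, ∑ t : Fin k, chainLaw (K i) (Pi.single i 1) (t + 1) + Pi.single i 1
      = ∑ t : Fin k, chainLaw (K i) (Pi.single i 1) t + R i := by
    intro i
    rw [Fin.sum_univ_eq_sum_range (fun t => chainLaw (K i) (Pi.single i 1) (t + 1)),
      Fin.sum_univ_eq_sum_range (fun t => chainLaw (K i) (Pi.single i 1) t), hK i,
      ← Finset.sum_range_succ, Finset.sum_range_succ']
    rfl
  have h2 : ∑ i, m i • R i = ∑ i, m i • (Pi.single i 1 : Fin n → ℝ) := by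
    ext b
    simp only [Finset.sum_apply, Pi.smul_apply, smul_eq_mul]
    rw [hm.sum_eq b]
    simp [Pi.single_apply]
  simp only [Fintype.sum_prod_type, smul_vecMul, ← Finset.smul_sum]
  refine add_right_cancel (b := ∑ i, m i • (Pi.single i 1 : Fin n → ℝ)) ?_
  nth_rewrite 2 [← h2]
  simp only [← Finset.sum_add_distrib, ← smul_add]
  exact Finset.sum_congr rfl fun i _ => congrArg _ (h1 i)

theorem hasPath_of_isInvariant_iterate (hconv : IsConvexMap f) (hmono : Monotone f)
    (hhom : IsAddHomogeneous f) (hv : IsEigenvector f v) {k : ℕ} (hk : 1 ≤ k)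
    {R : Matrix (Fin n) (Fin n) ℝ} (hR : R ∈ subdifferential f^[k] v) {m : Fin n → ℝ}
    (hm : IsInvariant m R) {i : Fin n} (hi : 0 < m i) :
    i ∈ (criticalGraph f v).nodes ∧ ∀ j, R i j ≠ 0 → (criticalGraph f v).HasPath k i j := by
  choose K hK hRK using fun i => exists_chainLaw_eq hconv hmono hhom hv i k
    (mem_subdifferential_iff.1 hR i)
  have hnn : ∀ i t a, 0 ≤ chainLaw (K i) (Pi.single i 1) t a := fun i t =>
    chainLaw_nonneg (fun t => mem_rowStochastic_of_mem_subdifferential hmono hhom (hK i t))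
      ((Pi.single_nonneg (α := fun _ : Fin n => ℝ)).2 zero_le_one) t
  obtain ⟨P, hP, μ, hμ, hsupp⟩ := exists_mixture hconv hmono hhom (S := Fin n × Fin k)
    (μ := fun s => m s.1 • chainLaw (K s.1) (Pi.single s.1 1) s.2) (K := fun s => K s.1 s.2)
    (fun s a => mul_nonneg (hm.nonneg s.1) (hnn _ _ a)) (fun s => hK s.1 s.2)
    (sum_chainLaw_succ_eq hm hRK)
  -- Here `1 ≤ k` is needed: time `0`, when the chain sits at `i`, must be among the times mixed.
  have hnode : i ∈ (criticalGraph f v).nodes :=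
    (mem_criticalGraph_nodes_iff hmono hhom).2 ⟨P, hP, μ, hμ,
      (hsupp (i, ⟨0, hk⟩) i (by simpa [chainLaw] using hi)).1⟩
  have hpath : ∀ t ≤ k, ∀ b, chainLaw (K i) (Pi.single i 1) t b ≠ 0 →
      (criticalGraph f v).HasPath t i b := by
    intro t
    induction t with
    | zero =>
      intro _ b hb
      refine ⟨hnode, ?_⟩
      by_contra h
      exact hb (Pi.single_eq_of_ne (Ne.symm h) _)
    | succ t ih =>
      intro ht b hb
      obtain ⟨a, -, ha⟩ := Finset.exists_ne_zero_of_sum_ne_zero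
        (show ∑ a, chainLaw (K i) (Pi.single i 1) t a * K i t a b ≠ 0 from hb)
      have ha1 := left_ne_zero_of_mul ha
      obtain ⟨h1, h2⟩ := hsupp (i, ⟨t, ht⟩) a
        (mul_pos hi (lt_of_le_of_ne (hnn i t a) ha1.symm))
      exact ⟨a, ih (t.le_succ.trans ht) a ha1, (criticalGraph_arc_iff hmono hhom).2
        ⟨P, hP, μ, hμ, h1, h2 b (right_ne_zero_of_mul ha)⟩⟩
  exact ⟨hnode, fun j hj => hpath k le_rfl j (by rwa [← hRK i])⟩

theorem pow_pos_of_hasPath {P : Matrix (Fin n) (Fin n) ℝ} (hP : P ∈ rowStochastic ℝ (Fin n))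
    {G : NodeDigraph (Fin n)} (hG : ∀ i j, G.Arc i j → P i j ≠ 0) {k : ℕ} {i j : Fin n}
    (h : G.HasPath k i j) : 0 < (P ^ k) i j := by
  induction k generalizing j with
  | zero =>
    obtain ⟨-, rfl⟩ := h
    simp
  | succ k ih =>
    obtain ⟨l, hl, hlj⟩ := h
    rw [pow_succ, mul_apply]
    exact Finset.sum_pos' (fun a _ => mul_nonneg
      (nonneg_of_mem_rowStochastic (Submonoid.pow_mem _ hP k)) (nonneg_of_mem_rowStochastic hP))
      ⟨l, Finset.mem_univ l, mul_pos (ih hl)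
        (lt_of_le_of_ne (nonneg_of_mem_rowStochastic hP) (hG l j hlj).symm)⟩

theorem criticalGraph_iterate (hconv : IsConvexMap f) (hmono : Monotone f)
    (hhom : IsAddHomogeneous f) (hv : IsEigenvector f v) {k : ℕ} (hk : 1 ≤ k) :
    criticalGraph f^[k] v = criticalGraph f v ^ k := by
  obtain ⟨P, hP, m, hm, hnodes, harcs⟩ := exists_maximal_subgradient hconv hmono hhom v
  have hmono' := hmono.iterate k
  have hhom' := hhom.iterate k
  have hPk := pow_mem_subdifferential_iterate hmono hhom hv hP k
  refine NodeDigraph.ext (Set.ext fun i => ⟨fun hi => ?_, fun hi => ?_⟩) ?_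
  · obtain ⟨R, hR, μ, hμ, hi⟩ := (mem_criticalGraph_nodes_iff hmono' hhom').1 hi
    exact (hasPath_of_isInvariant_iterate hconv hmono hhom hv hk hR hμ hi).1
  · exact (mem_criticalGraph_nodes_iff hmono' hhom').2 ⟨_, hPk, m, hm.pow k, hnodes i hi⟩
  · ext i j
    constructor
    · intro hij
      obtain ⟨R, hR, μ, hμ, hi, hij⟩ := (criticalGraph_arc_iff hmono' hhom').1 hij
      exact (hasPath_of_isInvariant_iterate hconv hmono hhom hv hk hR hμ hi).2 j hij
    · intro (hij : (criticalGraph f v).HasPath k i j)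
      exact (criticalGraph_arc_iff hmono' hhom').2 ⟨_, hPk, m, hm.pow k, hnodes i hij.left_mem,
        (pow_pos_of_hasPath (mem_rowStochastic_of_mem_subdifferential hmono hhom hP) harcs
          hij).ne'⟩

end Iterates

end ConvexSpectral

theorem theorem4p1 {n : ℕ} (f : (Fin n → ℝ) → (Fin n → ℝ))
    (hconv : ConvexSpectral.IsConvexMap f) (hmono : Monotone f)
    (hhom : ConvexSpectral.IsAddHomogeneous f)
    (heig : ∃ v, ConvexSpectral.IsEigenvector f v) (k : ℕ) (hk : 1 ≤ k) :
    (∃ w, ConvexSpectral.IsEigenvector f^[k] w) ∧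
    ∀ v w, ConvexSpectral.IsEigenvector f v → ConvexSpectral.IsEigenvector f^[k] w →
      ConvexSpectral.criticalGraph f^[k] w = ConvexSpectral.criticalGraph f v ^ k ∧
      ConvexSpectral.criticalNodes f^[k] w = ConvexSpectral.criticalNodes f v := by
  obtain ⟨u, hu⟩ := heig
  refine ⟨⟨u, hu.iterate hhom k⟩, fun v w hv hw => ?_⟩
  -- `w` need not be an eigenvector of `f`, so the base point is first moved to `v`, which is one of
  -- both maps.
  have key : ConvexSpectral.criticalGraph f^[k] w = ConvexSpectral.criticalGraph f v ^ k := by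
    rw [ConvexSpectral.criticalGraph_congr (hconv.iterate hmono k) (hmono.iterate k)
      (hhom.iterate k) hw (hv.iterate hhom k),
      ConvexSpectral.criticalGraph_iterate hconv hmono hhom hv hk]
  refine ⟨key, ?_⟩
  rw [ConvexSpectral.criticalNodes, key]
  rfl
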